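/- Let $2^{<\omega}$ be the set of all finite sequences of $0$s and $1$s (including the empty one), partially ordered by $s\sqsubseteq t$ iff $s$ is an initial segment of $t$, and linearly ordered by $s<t$ iff $s$ is shorter than $t$, or $s,t$ have equal length and $s$ has a $0$ and $t$ a $1$ at the first place where they differ. An antichain is a set of pairwise $\sqsubseteq$-incomparable nodes; two sets $\sigma,\tau$ of nodes are incomparable, $\sigma\perp\tau$, if every $s\in\sigma$ is $\sqsubseteq$-incomparable to every $t\in\tau$. Let $E$ be a real Banach space with a Schauder basis $(e_t)_{t\in 2^{<\omega}}$ (indexed in the order $<$) that is $1$-subsymmetric, i.e. for all finitely supported scalar families $(a_t)$, $(\gamma_t)$ one has $\|\sum_t\gamma_t a_te_t\|_E\le\sup_t|\gamma_t|\,\|\sum_t a_te_t\|_E$, and $\|\sum_t a_te_t\|_E=\|\sum_t a_te_{s_t}\|_E$ whenever $t_1<t_2$ implies $s_{t_1}<s_{t_2}$. Let $S^E$ be the completion of the space of finitely supported scalar families on $2^{<\omega}$ with respect to the norm $$\|(a_t)\|_{S^E}=\sup\Big\{\Big\|\sum_{t\in\mathcal A}a_te_t\Big\|_E:\ \mathcal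 A\subset 2^{<\omega}\text{ an antichain}\Big\},$$ and let $D^E=(S^E)^*$. From here on, write $(e_s)_{s\in 2^{<\omega}}$ also for the unit vector basis of $S^E$, and $(f_s)_{s\in 2^{<\omega}}$ for its biorthogonal functionals in $D^E$. Suppose that the basis of $E$ is incomparably non-$c_0$ on antichains, i.e. for all sets $\sigma_1,\sigma_2,\ldots\subset 2^{<\omega}$ with $\sigma_j\perp\sigma_k$ for $j\ne k$, $$\inf_{\substack{N\in\mathbb N\\ \sum_{j\le N}|a_j|=1}}\ \sup\Big\{\sum_{j=1}^N|a_j|\,\|z_j\|_E:\ \mathcal A\text{ an antichain},\ z_j\in E,\ \operatorname{supp}(z_j)\subset\sigma_j\cap\mathcal A,\ \Big\|\sum_{j=1}^Nz_j\Big\|_E=1\Big\}=0$$ (with $\sup\emptyset=0$). Let $T\colon D^E\to D^E$ be a bounded linear operator with large diagonal with respect to $(f_s)$, i.e. $$\delta=\inf_{s\in 2^{<\omega}}|\langle e_s,Tf_s\rangle|>0 .$$ Then for every $\eta>0$ there exist bounded linear operators $A,B\colon D^E\to D^E$ such that $ATB=I_{D^E}$ and $\|A\|\,\|B\|\le\frac{1+\eta}{\delta}$.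 -/

import Mathlib

noncomputable section

namespace StoppingTime

/-! ### The dyadic tree -/

/-- Nodes of the rooted dyadic tree: finite sequences of `0`s (`false`) and `1`s (`true`).
The initial-segment partial order is `s <+: t`. -/
abbrev Node : Type := List Bool

/-- The standard linear order: `s < t` iff `s` is shorter than `t`, or the lengths agree and
`s` is to the left of `t` (there is a `0` in `s` at the first place where they differ). -/
def Node.LT (s t : Node) : Prop := List.Shortlex (· < ·) s t

/-- Antichains: sets of pairwise incomparable nodes. -/
def IsTreeAntichain (A : Set Node) : Prop := IsAntichain (fun s t : Node => s <+: t) A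

/-- Incomparable sets of nodes: every element of one is incomparable to every element of the
other. -/
def Incomparable (A B : Set Node) : Prop :=
  ∀ s ∈ A, ∀ t ∈ B, ¬ s <+: t ∧ ¬ t <+: s

/-- The position of a node in the standard linear order, counted from the root at `0`; the
children of the node with number `n` have the numbers `2n+1` and `2n+2`. -/
def Node.number (t : Node) : ℕ := t.foldl (fun n x => 2 * n + 1 + x.toNat) 0

theorem Node.foldl_mono (s t : Node) (h : s.length = t.length) (n m : ℕ) (hnm : n < m) :
    s.foldl (fun n x => 2 * n + 1 + x.toNat) n < t.foldl (fun n x => 2 * n + 1 + x.toNat) m := by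
  induction s generalizing t n m with
  | nil =>
    have : t = [] := List.length_eq_zero_iff.1 h.symm
    subst this; simpa using hnm
  | cons a s ih =>
    cases t with
    | nil => simp at h
    | cons c t =>
      simp only [List.foldl_cons]
      refine ih t (by simpa using h) _ _ ?_
      cases a <;> cases c <;> simp <;> omega

theorem Node.foldl_lex (s t : Node) (h : s.length = t.length) (hl : List.Lex (· < ·) s t) (n : ℕ) :
    s.foldl (fun n x => 2 * n + 1 + x.toNat) n < t.foldl (fun n x => 2 * n + 1 + x.toNat) n := by
  induction hl generalizing n with
  | nil => simp at h
  | cons _ ih => exact ih (by simpa using h) _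
  | @rel a s c t hac =>
    simp only [List.foldl_cons]
    refine Node.foldl_mono s t (by simpa using h) _ _ ?_
    revert hac
    cases a <;> cases c <;> simp

theorem Node.foldl_bounds (s : Node) (n : ℕ) :
    2 ^ s.length * (n + 1) ≤ s.foldl (fun n x => 2 * n + 1 + x.toNat) n + 1 ∧
      s.foldl (fun n x => 2 * n + 1 + x.toNat) n + 1 < 2 ^ s.length * (n + 2) := by
  induction s generalizing n with
  | nil => simp
  | cons a s ih =>
    have h1 := (ih (2 * n + 1 + a.toNat)).1
    have h2 := (ih (2 * n + 1 + a.toNat)).2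
    have hp : 0 < 2 ^ s.length := by positivity
    simp only [List.foldl_cons, List.length_cons, pow_succ]
    cases a <;> simp at h1 h2 ⊢ <;> constructor <;> nlinarith

theorem Node.number_lt_of_LT {s t : Node} (h : s.LT t) : s.number < t.number := by
  rcases List.shortlex_def.1 h with h | ⟨h, hl⟩
  · have h1 := (Node.foldl_bounds s 0).2
    have h2 := (Node.foldl_bounds t 0).1
    have h3 : 2 ^ (s.length + 1) ≤ 2 ^ t.length := Nat.pow_le_pow_right (by norm_num) h
    rw [pow_succ] at h3
    unfold Node.number
    omega
  · exact Node.foldl_lex s t h hl 0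

theorem Node.LT_trichotomy (s t : Node) : s.LT t ∨ s = t ∨ t.LT s := by
  by_contra hc
  push Not at hc
  exact hc.2.1 ((Std.Trichotomous.trichotomous (r := List.Shortlex (α := Bool) (· < ·)))
    s t hc.1 hc.2.2)

/-- The numbering of the nodes is increasing for the standard linear order. -/
theorem Node.number_lt_iff {s t : Node} : s.number < t.number ↔ s.LT t := by
  refine ⟨fun h => ?_, Node.number_lt_of_LT⟩
  rcases Node.LT_trichotomy s t with h' | rfl | h'
  · exact h'
  · exact absurd h (lt_irrefl _)
  · exact absurd (Node.number_lt_of_LT h') (by omega)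

/-- The numbering of the nodes is a bijection onto `ℕ`. -/
theorem Node.number_bijective : Function.Bijective Node.number := by
  constructor
  · intro s t h
    rcases Node.LT_trichotomy s t with h' | h' | h'
    · exact absurd (Node.number_lt_of_LT h') (by omega)
    · exact h'
    · exact absurd (Node.number_lt_of_LT h') (by omega)
  · intro n
    induction n using Nat.strong_induction_on with
    | _ n ih =>
      rcases Nat.eq_zero_or_pos n with rfl | hn
      · exact ⟨[], rfl⟩
      · obtain ⟨t, ht⟩ := ih ((n - 1) / 2) (by omega)
        unfold Node.number at ht
        rcases Nat.mod_two_eq_zero_or_one n with h | h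
        · refine ⟨t ++ [true], ?_⟩
          simp only [Node.number, List.foldl_append, ht, List.foldl_cons, List.foldl_nil,
            Bool.toNat_true]
          omega
        · refine ⟨t ++ [false], ?_⟩
          simp only [Node.number, List.foldl_append, ht, List.foldl_cons, List.foldl_nil,
            Bool.toNat_false]
          omega

/-! ### Bases indexed by the dyadic tree -/

variable {E : Type*} [NormedAddCommGroup E] [NormedSpace ℝ E]

/-- The vectors `e_t` of a Schauder basis, indexed by the nodes in the standard linear order. -/
def vec (b : SchauderBasis ℝ E) (t : Node) : E := b t.number

/-- The coordinate functionals `e_t^*` of a Schauder basis, indexed by the nodes. -/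
def coord (b : SchauderBasis ℝ E) (t : Node) : StrongDual ℝ E := b.coord t.number

/-- `∑ a_t e_t` for finitely supported `a`. -/
def synth (b : SchauderBasis ℝ E) : (Node →₀ ℝ) →ₗ[ℝ] E := Finsupp.linearCombination ℝ (vec b)

/-- The support of a vector: the set of nodes at which its coordinate does not vanish. -/
def supp (b : SchauderBasis ℝ E) (z : E) : Set Node := {t | coord b t z ≠ 0}

/-- `1`-unconditional: `‖∑ γ_t a_t e_t‖ ≤ sup |γ_t| ‖∑ a_t e_t‖` for finitely supported
`a` and `γ`. -/
def IsUnconditional (b : SchauderBasis ℝ E) : Prop :=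
  ∀ a γ : Node →₀ ℝ,
    ‖a.sum fun t x => (γ t * x) • vec b t‖ ≤ (⨆ t, |γ t|) * ‖a.sum fun t x => x • vec b t‖

/-- `1`-spreading: `‖∑ a_t e_t‖ = ‖∑ a_t e_{s_t}‖` for finitely supported `a` and every
family `s` of nodes that is increasing in the standard linear order. -/
def IsSpreading (b : SchauderBasis ℝ E) : Prop :=
  ∀ s : Node → Node, (∀ t₁ t₂ : Node, t₁.LT t₂ → (s t₁).LT (s t₂)) →
    ∀ a : Node →₀ ℝ,
      ‖a.sum fun t x => x • vec b t‖ = ‖a.sum fun t x => x • vec b (s t)‖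

/-- `1`-subsymmetric: `1`-unconditional and `1`-spreading. -/
def IsSubsymmetric (b : SchauderBasis ℝ E) : Prop := IsUnconditional b ∧ IsSpreading b

/-- Incomparably non-`c₀` on antichains. -/
def IncomparablyNonC0 (b : SchauderBasis ℝ E) : Prop :=
  ∀ σ : ℕ → Set Node, (∀ j k, j ≠ k → Incomparable (σ j) (σ k)) →
    (⨅ (N : ℕ) (a : Fin N → ℝ) (_ : ∑ j, |a j| = 1),
      ⨆ (A : Set Node) (_ : IsTreeAntichain A) (z : Fin N → E)
        (_ : ∀ j, supp b (z j) ⊆ σ j ∩ A) (_ : ‖∑ j, z j‖ = 1),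
        ENNReal.ofReal (∑ j, |a j| * ‖z j‖)) = 0

/-! ### The stopping-time space `S^E` and its dual `D^E` -/

/-- `c₀₀` of the dyadic tree, to be equipped with the norm of `S^E`. -/
def C00 (_b : SchauderBasis ℝ E) : Type := Node →₀ ℝ

instance (b : SchauderBasis ℝ E) : AddCommGroup (C00 b) :=
  inferInstanceAs (AddCommGroup (Node →₀ ℝ))

instance (b : SchauderBasis ℝ E) : Module ℝ (C00 b) :=
  inferInstanceAs (Module ℝ (Node →₀ ℝ))

/-- An element of `c₀₀` as a finitely supported family of scalars. -/
def C00.toFinsupp {b : SchauderBasis ℝ E} (a : C00 b) : Node →₀ ℝ := a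

/-- A finitely supported family of scalars as an element of `c₀₀`. -/
def C00.ofFinsupp (b : SchauderBasis ℝ E) (a : Node →₀ ℝ) : C00 b := a

open Classical in
/-- The restriction `P_A a` of `a` to the set `A` of nodes, as a vector of `E`. -/
def restr (b : SchauderBasis ℝ E) (A : Set Node) : C00 b →ₗ[ℝ] E where
  toFun a := synth b (Finsupp.filter (fun t => t ∈ A) a.toFinsupp)
  map_add' x y := by
    rw [← map_add]; exact congrArg (synth b) Finsupp.filter_add
  map_smul' c x := by
    rw [← map_smul]; exact congrArg (synth b) Finsupp.filter_smul

/-- The norm of `S^E` on `c₀₀`: the supremum of `‖P_A a‖` over all antichains `A`. -/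
instance (b : SchauderBasis ℝ E) : Norm (C00 b) :=
  ⟨fun a => ⨆ A : {A : Set Node // IsTreeAntichain A}, ‖restr b A.1 a‖⟩

theorem norm_def (b : SchauderBasis ℝ E) (a : C00 b) :
    ‖a‖ = ⨆ A : {A : Set Node // IsTreeAntichain A}, ‖restr b A.1 a‖ := rfl

instance : Nonempty {A : Set Node // IsTreeAntichain A} :=
  ⟨⟨∅, Set.pairwise_empty _⟩⟩

theorem restr_bddAbove (b : SchauderBasis ℝ E) (a : C00 b) :
    BddAbove (Set.range fun A : {A : Set Node // IsTreeAntichain A} => ‖restr b A.1 a‖) := by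
  classical
  let a' : Node →₀ ℝ := a
  refine ⟨∑ t ∈ a'.support, ‖a' t • vec b t‖, ?_⟩
  rintro _ ⟨A, rfl⟩
  have h : restr b A.1 a = ∑ t ∈ a'.support.filter (fun t => t ∈ A.1), a' t • vec b t := by
    change Finsupp.linearCombination ℝ (vec b) (Finsupp.filter (fun t => t ∈ A.1) a') = _
    rw [Finsupp.linearCombination_apply, Finsupp.sum, Finsupp.support_filter]
    refine Finset.sum_congr rfl fun t ht => ?_
    rw [Finsupp.filter_apply_pos _ _ (Finset.mem_filter.1 ht).2]
  change ‖restr b A.1 a‖ ≤ _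
  rw [h]
  refine (norm_sum_le _ _).trans ?_
  exact Finset.sum_le_sum_of_subset_of_nonneg (Finset.filter_subset _ _)
    fun _ _ _ => norm_nonneg _

theorem norm_restr_le (b : SchauderBasis ℝ E) {A : Set Node} (hA : IsTreeAntichain A) (a : C00 b) :
    ‖restr b A a‖ ≤ ‖a‖ :=
  le_ciSup (restr_bddAbove b a) ⟨A, hA⟩

theorem restr_singleton (b : SchauderBasis ℝ E) (t : Node) (a : C00 b) :
    restr b {t} a = a.toFinsupp t • vec b t := by
  classical
  have : Finsupp.filter (fun s => s ∈ ({t} : Set Node)) a.toFinsupp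
      = Finsupp.single t (a.toFinsupp t) := by
    ext s
    by_cases hs : s = t
    · subst hs; rw [Finsupp.filter_apply_pos _ _ (Set.mem_singleton _)]; simp
    · rw [Finsupp.filter_apply_neg _ _ (by simpa using hs), Finsupp.single_eq_of_ne hs]
  have h2 : restr b {t} a = synth b (Finsupp.single t (a.toFinsupp t)) := by
    rw [← this]
    simp only [restr, LinearMap.coe_mk, AddHom.coe_mk]
    congr!
  rw [h2]
  exact Finsupp.linearCombination_single _ _ _

theorem vec_ne_zero (b : SchauderBasis ℝ E) (t : Node) : vec b t ≠ 0 :=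
  b.linearIndependent.ne_zero _

theorem abs_apply_le (b : SchauderBasis ℝ E) (t : Node) (a : C00 b) :
    |a.toFinsupp t| ≤ ‖vec b t‖⁻¹ * ‖a‖ := by
  have h := norm_restr_le b (A := {t}) (Set.pairwise_singleton _ _) a
  rw [restr_singleton, norm_smul, Real.norm_eq_abs] at h
  have h0 : 0 < ‖vec b t‖ := norm_pos_iff.2 (vec_ne_zero b t)
  rw [inv_mul_eq_div, le_div_iff₀ h0]
  exact h

theorem normCore (b : SchauderBasis ℝ E) : NormedSpace.Core ℝ (C00 b) where
  norm_nonneg a := Real.iSup_nonneg fun _ => norm_nonneg _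
  norm_smul c a := by
    rw [norm_def, norm_def, Real.norm_eq_abs, Real.mul_iSup_of_nonneg (abs_nonneg c)]
    simp only [map_smul, norm_smul, Real.norm_eq_abs]
  norm_triangle x y := by
    refine ciSup_le fun A => ?_
    rw [map_add]
    exact (norm_add_le _ _).trans (add_le_add (norm_restr_le b A.2 x) (norm_restr_le b A.2 y))
  norm_eq_zero_iff a := by
    constructor
    · intro h
      refine Finsupp.ext fun t => ?_
      have := abs_apply_le b t a
      rw [h, mul_zero] at this
      exact abs_nonpos_iff.1 this
    · rintro rfl
      simp [norm_def]

instance (b : SchauderBasis ℝ E) : NormedAddCommGroup (C00 b) :=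
  NormedAddCommGroup.ofCore (normCore b)

instance (b : SchauderBasis ℝ E) : NormedSpace ℝ (C00 b) :=
  NormedSpace.ofCore (normCore b)

/-- The stopping-time space `S^E`. -/
abbrev SSpace (b : SchauderBasis ℝ E) : Type := UniformSpace.Completion (C00 b)

/-- The dual `D^E = (S^E)^*`. -/
abbrev DSpace (b : SchauderBasis ℝ E) : Type := StrongDual ℝ (SSpace b)

/-- The unit vector basis `e_s` of `S^E`. -/
def e (b : SchauderBasis ℝ E) (s : Node) : SSpace b :=
  (C00.ofFinsupp b (Finsupp.single s 1) : SSpace b)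

/-- The coordinate functional `a ↦ a_s` on `c₀₀`. -/
def coord00 (b : SchauderBasis ℝ E) (s : Node) : C00 b →L[ℝ] ℝ :=
  LinearMap.mkContinuous
    (show C00 b →ₗ[ℝ] ℝ from (Finsupp.lapply s : (Node →₀ ℝ) →ₗ[ℝ] ℝ))
    ‖vec b s‖⁻¹ (fun a => abs_apply_le b s a)

/-- The biorthogonal functional `f_s ∈ D^E`: the continuous extension of `a ↦ a_s`. -/
def f (b : SchauderBasis ℝ E) (s : Node) : DSpace b :=
  (coord00 b s).extend UniformSpace.Completion.toComplL

theorem f_coe (b : SchauderBasis ℝ E) (s : Node) (a : C00 b) :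
    f b s (a : SSpace b) = a.toFinsupp s :=
  ContinuousLinearMap.extend_eq (e := UniformSpace.Completion.toComplL) (coord00 b s)
    UniformSpace.Completion.denseRange_coe
    (UniformSpace.Completion.isUniformInducing_coe _) a

/-- The systems `(e_s)` and `(f_s)` are biorthogonal. -/
theorem f_e (b : SchauderBasis ℝ E) (s t : Node) : f b s (e b t) = if s = t then 1 else 0 := by
  rw [e, f_coe]
  exact Finsupp.single_apply.trans (by simp only [eq_comm])

end StoppingTime

end

/-! The identity factors through `T` because `T` is nearly diagonal on a suitable copy of the tree.
`T` need not be an adjoint and the `f b s` need not span a dense subspace of `D^E`, so small matrix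
entries do not suffice: each row functional `entry T x` must be small on every functional supported
on the other chosen nodes (`SmallOn`).

Two facts provide this. By `exists_smallOn`, a functional on `D^E` is small on one of any infinitely
many incomparable sets: otherwise normalized bad functionals `g j` would have a convex combination
of tiny norm, by the non-`c₀` condition and duality, on which the functional still equals 1. So
every cone contains a cone where a given row is small. By `sum_abs_branch_le`, chains span `c₀` in
`S^E`, so a functional in `D^E` has summable coefficients along a branch; going deep makes the
entries against the earlier nodes small.

`exists_subtree` alternates the two steps. Subsymmetry makes the passage to the subtree and back
contractive, inverting the diagonal costs `δ⁻¹`, and a Neumann series removes the remaining error at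
the cost of a factor `1 + η`. -/

noncomputable section

namespace StoppingTime

open UniformSpace

variable {E : Type*} [NormedAddCommGroup E] [NormedSpace ℝ E]

/-! ### Sums along a basis -/

theorem synth_apply (b : SchauderBasis ℝ E) (a : Node →₀ ℝ) :
    synth b a = a.sum fun t x => x • vec b t := Finsupp.linearCombination_apply _ _

theorem coord_synth (b : SchauderBasis ℝ E) (a : Node →₀ ℝ) (t : Node) :
    coord b t (synth b a) = a t := by
  classical
  rw [synth_apply, Finsupp.sum, map_sum]
  have h : ∀ s : Node, coord b t (a s • vec b s) = if s = t then a s else 0 := by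
    intro s
    rw [map_smul, coord, vec, b.ortho]
    by_cases hs : s = t
    · subst hs; simp
    · have : s.number ≠ t.number := fun h => hs (Node.number_bijective.1 h)
      simp [hs, this.symm]
  simp only [h, Finset.sum_ite_eq', Finsupp.mem_support_iff, ite_not]
  split_ifs with h0
  · exact h0.symm
  · rfl

/-- Coordinatewise multiplication of a finitely supported family. -/
def mulCoeff (γ : Node → ℝ) : (Node →₀ ℝ) →ₗ[ℝ] (Node →₀ ℝ) :=
  Finsupp.lsum ℝ fun t => γ t • Finsupp.lsingle t

@[simp] theorem mulCoeff_apply (γ : Node → ℝ) (a : Node →₀ ℝ) (t : Node) :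
    mulCoeff γ a t = γ t * a t := by
  induction a using Finsupp.induction_linear with
  | zero => simp
  | add x y hx hy => rw [map_add, Finsupp.add_apply, hx, hy, Finsupp.add_apply, mul_add]
  | single s x =>
    by_cases hs : s = t
    · subst hs; simp [mulCoeff]
    · simp [mulCoeff, Finsupp.single_eq_of_ne (Ne.symm hs)]

theorem mulCoeff_single (γ : Node → ℝ) (t : Node) (x : ℝ) :
    mulCoeff γ (Finsupp.single t x) = Finsupp.single t (γ t * x) := by
  ext s
  by_cases hs : s = t
  · subst hs; simp
  · simp [Finsupp.single_eq_of_ne hs]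

theorem synth_mulCoeff (b : SchauderBasis ℝ E) (γ : Node → ℝ) (a : Node →₀ ℝ) :
    synth b (mulCoeff γ a) = a.sum fun t x => (γ t * x) • vec b t := by
  induction a using Finsupp.induction_linear with
  | zero => simp
  | add x y hx hy =>
    rw [map_add, map_add, hx, hy, Finsupp.sum_add_index']
    · simp
    · intro t u v; rw [mul_add, add_smul]
  | single s x =>
    rw [Finsupp.sum_single_index (by simp)]
    rw [mulCoeff_single]
    exact Finsupp.linearCombination_single _ _ _

theorem norm_synth_mulCoeff_le {b : SchauderBasis ℝ E} (hb : IsUnconditional b) {γ : Node → ℝ}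
    {C : ℝ} (hC : 0 ≤ C) (hγ : ∀ t, |γ t| ≤ C) (a : Node →₀ ℝ) :
    ‖synth b (mulCoeff γ a)‖ ≤ C * ‖synth b a‖ := by
  classical
  -- Unconditionality admits only finitely supported multipliers, so `γ` is cut off outside the
  -- support of `a`.
  let γ' : Node →₀ ℝ := Finsupp.onFinset a.support (fun t => if t ∈ a.support then γ t else 0)
    (fun t ht => by by_contra h; exact ht (if_neg h))
  have h := hb a γ'
  rw [synth_mulCoeff, synth_apply]
  have h1 : (a.sum fun t x => (γ' t * x) • vec b t) = a.sum fun t x => (γ t * x) • vec b t := by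
    refine Finset.sum_congr rfl fun t ht => ?_
    have : γ' t = γ t := by simp only [γ', Finsupp.onFinset_apply, if_pos ht]
    simp only [this]
  rw [h1] at h
  refine h.trans (mul_le_mul_of_nonneg_right (ciSup_le fun t => ?_) (norm_nonneg _))
  simp only [γ', Finsupp.onFinset_apply]
  split_ifs
  · exact hγ t
  · simpa using hC

open Classical in
theorem restr_eq_synth (b : SchauderBasis ℝ E) (A : Set Node) (a : C00 b) :
    restr b A a = synth b (mulCoeff (A.indicator 1) a.toFinsupp) := by
  change synth b _ = _
  congr 1
  ext t
  by_cases ht : t ∈ A <;> simp [ht]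

theorem norm_le_of_restr {b : SchauderBasis ℝ E} {a : C00 b} {M : ℝ}
    (h : ∀ A, IsTreeAntichain A → ‖restr b A a‖ ≤ M) : ‖a‖ ≤ M :=
  ciSup_le fun A => h A.1 A.2

/-- The factor 2 avoids showing that the supremum is attained. -/
theorem exists_norm_le_two_mul_norm_restr (b : SchauderBasis ℝ E) (a : C00 b) :
    ∃ A, IsTreeAntichain A ∧ ‖a‖ ≤ 2 * ‖restr b A a‖ := by
  by_contra! h
  have h1 : ‖a‖ ≤ ‖a‖ / 2 := norm_le_of_restr fun A hA => by linarith [h A hA]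
  have h2 := h ∅ (Set.pairwise_empty _)
  linarith [norm_nonneg (restr b ∅ a)]

/-! ### Operators on `D^E` that are induced by operators on `c₀₀` -/

/-- The continuous extension to `S^E` of a linear map on `c₀₀`. -/
def extendS {b : SchauderBasis ℝ E} (L : C00 b →ₗ[ℝ] C00 b) : SSpace b →L[ℝ] SSpace b :=
  (Completion.toComplₗᵢ.toLinearMap ∘ₗ L : C00 b →ₗ[ℝ] SSpace b).extendOfNorm
    (Completion.toComplₗᵢ.toLinearMap : C00 b →ₗ[ℝ] SSpace b)

theorem extendS_coe {b : SchauderBasis ℝ E} {L : C00 b →ₗ[ℝ] C00 b} {C : ℝ}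
    (hL : ∀ x, ‖L x‖ ≤ C * ‖x‖) (x : C00 b) : extendS L (x : SSpace b) = (L x : SSpace b) :=
  LinearMap.extendOfNorm_eq (f := Completion.toComplₗᵢ.toLinearMap ∘ₗ L)
    (e := (Completion.toComplₗᵢ.toLinearMap : C00 b →ₗ[ℝ] SSpace b))
    Completion.denseRange_coe ⟨C, fun x => by simpa using hL x⟩ x

theorem norm_extendS_le {b : SchauderBasis ℝ E} {L : C00 b →ₗ[ℝ] C00 b} {C : ℝ} (hC : 0 ≤ C)
    (hL : ∀ x, ‖L x‖ ≤ C * ‖x‖) : ‖extendS L‖ ≤ C :=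
  ContinuousLinearMap.opNorm_le_bound _ hC fun x => by
    induction x using Completion.induction_on with
    | hp => exact isClosed_le (by fun_prop) (by fun_prop)
    | ih x =>
      rw [extendS_coe hL, Completion.norm_coe, Completion.norm_coe]
      exact hL x

/-- The operator `g ↦ g ∘ L` on `D^E`. -/
def pullback {b : SchauderBasis ℝ E} (L : C00 b →ₗ[ℝ] C00 b) : DSpace b →L[ℝ] DSpace b :=
  (ContinuousLinearMap.compL ℝ (SSpace b) (SSpace b) ℝ).flip (extendS L)

theorem pullback_coe {b : SchauderBasis ℝ E} {L : C00 b →ₗ[ℝ] C00 b} {C : ℝ}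
    (hL : ∀ x, ‖L x‖ ≤ C * ‖x‖) (g : DSpace b) (x : C00 b) :
    pullback L g (x : SSpace b) = g (L x : SSpace b) := by
  rw [← extendS_coe hL]; rfl

theorem norm_pullback_le {b : SchauderBasis ℝ E} {L : C00 b →ₗ[ℝ] C00 b} {C : ℝ} (hC : 0 ≤ C)
    (hL : ∀ x, ‖L x‖ ≤ C * ‖x‖) : ‖pullback L‖ ≤ C :=
  ContinuousLinearMap.opNorm_le_bound _ hC fun g => by
    refine (ContinuousLinearMap.opNorm_comp_le g (extendS L)).trans ?_
    rw [mul_comm]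
    exact mul_le_mul_of_nonneg_right (norm_extendS_le hC hL) (norm_nonneg _)

theorem norm_le_of_forall_coe {b : SchauderBasis ℝ E} {g : DSpace b} {M : ℝ} (hM : 0 ≤ M)
    (h : ∀ x : C00 b, |g (x : SSpace b)| ≤ M * ‖x‖) : ‖g‖ ≤ M :=
  ContinuousLinearMap.opNorm_le_bound _ hM fun x => by
    induction x using Completion.induction_on with
    | hp => exact isClosed_le (by fun_prop) (by fun_prop)
    | ih x => simpa using h x

theorem coe_eq_sum (b : SchauderBasis ℝ E) (x : C00 b) :
    (x : SSpace b) = x.toFinsupp.sum fun t r => r • e b t := by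
  let L : (Node →₀ ℝ) →ₗ[ℝ] SSpace b :=
    (Completion.toComplₗᵢ (𝕜 := ℝ) (E := C00 b)).toLinearMap ∘ₗ
      (show (Node →₀ ℝ) →ₗ[ℝ] C00 b from LinearMap.id)
  have h : L = Finsupp.linearCombination ℝ (e b) := by
    ext t
    simp only [L, LinearMap.comp_apply, Finsupp.lsingle_apply, Finsupp.linearCombination_single,
      one_smul]
    rfl
  have := LinearMap.congr_fun h x.toFinsupp
  rw [Finsupp.linearCombination_apply] at this
  exact this

theorem apply_coe_eq_sum {b : SchauderBasis ℝ E} (g : DSpace b) (x : C00 b) :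
    g (x : SSpace b) = x.toFinsupp.sum fun t r => r * g (e b t) := by
  rw [coe_eq_sum, Finsupp.sum, map_sum]
  simp [Finsupp.sum]

/-- Finitely supported families are dense in `S^E`, so identities in `D^E` can be checked
coordinatewise even where the `f b t` do not span. -/
theorem DSpace.ext_e {b : SchauderBasis ℝ E} {g h : DSpace b}
    (H : ∀ t, g (e b t) = h (e b t)) : g = h := by
  have h0 : ‖g - h‖ ≤ 0 := norm_le_of_forall_coe le_rfl fun x => by
    rw [sub_apply, apply_coe_eq_sum, apply_coe_eq_sum]
    simp [H]
  exact sub_eq_zero.1 (norm_le_zero_iff.1 h0)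

/-! ### Multipliers -/

/-- Coordinatewise multiplication on `c₀₀`. -/
def mult (b : SchauderBasis ℝ E) (γ : Node → ℝ) : C00 b →ₗ[ℝ] C00 b :=
  (show (Node →₀ ℝ) →ₗ[ℝ] (Node →₀ ℝ) from mulCoeff γ)

theorem restr_mult (b : SchauderBasis ℝ E) (γ : Node → ℝ) (A : Set Node) (x : C00 b) :
    restr b A (mult b γ x) = synth b (mulCoeff γ (mulCoeff (A.indicator 1) x.toFinsupp)) := by
  rw [restr_eq_synth]
  congr 1
  ext t
  change mulCoeff _ (mulCoeff γ _) t = _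
  rw [mulCoeff_apply, mulCoeff_apply, mulCoeff_apply]
  refine (congrArg _ (mulCoeff_apply γ x.toFinsupp t)).trans ?_
  exact mul_left_comm _ _ _

theorem norm_mult_le {b : SchauderBasis ℝ E} (hb : IsUnconditional b) {γ : Node → ℝ}
    {C : ℝ} (hC : 0 ≤ C) (hγ : ∀ t, |γ t| ≤ C) (x : C00 b) : ‖mult b γ x‖ ≤ C * ‖x‖ :=
  norm_le_of_restr fun A hA => by
    rw [restr_mult]
    refine (norm_synth_mulCoeff_le hb hC hγ _).trans ?_
    rw [← restr_eq_synth]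
    exact mul_le_mul_of_nonneg_left (norm_restr_le b hA x) hC

theorem mult_single (b : SchauderBasis ℝ E) (γ : Node → ℝ) (t : Node) :
    mult b γ (C00.ofFinsupp b (Finsupp.single t 1)) = γ t • C00.ofFinsupp b (Finsupp.single t 1) := by
  refine (mulCoeff_single γ t 1).trans ?_
  exact (Finsupp.smul_single' (γ t) t (1 : ℝ)).symm

theorem pullback_mult_e {b : SchauderBasis ℝ E} (hb : IsUnconditional b) {γ : Node → ℝ}
    {C : ℝ} (hC : 0 ≤ C) (hγ : ∀ t, |γ t| ≤ C) (g : DSpace b) (t : Node) :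
    pullback (mult b γ) g (e b t) = γ t * g (e b t) := by
  rw [e, pullback_coe (norm_mult_le hb hC hγ), mult_single, Completion.coe_smul, map_smul]
  rfl

/-- The restriction of a functional in `D^E` to a set of nodes. -/
def restrD (b : SchauderBasis ℝ E) (σ : Set Node) : DSpace b →L[ℝ] DSpace b :=
  pullback (mult b (σ.indicator 1))

theorem abs_indicator_one_le (σ : Set Node) (t : Node) : |σ.indicator (1 : Node → ℝ) t| ≤ 1 := by
  by_cases h : t ∈ σ <;> simp [h]

open Classical in
theorem restrD_e {b : SchauderBasis ℝ E} (hb : IsUnconditional b) (σ : Set Node) (g : DSpace b)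
    (t : Node) : restrD b σ g (e b t) = if t ∈ σ then g (e b t) else 0 := by
  rw [restrD, pullback_mult_e hb zero_le_one (abs_indicator_one_le σ)]
  by_cases h : t ∈ σ <;> simp [h]

theorem norm_restrD_apply_le {b : SchauderBasis ℝ E} (hb : IsUnconditional b) (σ : Set Node)
    (g : DSpace b) : ‖restrD b σ g‖ ≤ ‖g‖ := by
  have h : ‖restrD b σ‖ ≤ 1 :=
    norm_pullback_le zero_le_one (norm_mult_le hb zero_le_one (abs_indicator_one_le σ))
  simpa using (restrD b σ).le_of_opNorm_le h g

/-- A functional in `D^E` vanishes outside a set of nodes. -/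
def SupportedOn {b : SchauderBasis ℝ E} (g : DSpace b) (σ : Set Node) : Prop :=
  ∀ t ∉ σ, g (e b t) = 0

/-- Used to bound `g` at `x` by the norm of the restriction of `x` to `σ` alone. -/
theorem SupportedOn.apply_coe {b : SchauderBasis ℝ E} (hb : IsUnconditional b) {g : DSpace b}
    {σ : Set Node} (hg : SupportedOn g σ) (x : C00 b) :
    g (x : SSpace b) = g (mult b (σ.indicator 1) x : SSpace b) := by
  have : restrD b σ g = g := DSpace.ext_e fun t => by
    rw [restrD_e hb]
    split_ifs with h
    · rfl
    · exact (hg t h).symm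
  conv_lhs => rw [← this]
  exact pullback_coe (norm_mult_le hb zero_le_one (abs_indicator_one_le σ)) g x

/-! ### Smallness of functionals on supports -/

/-- The functional `φ` is at most `ε` on the unit ball of the functionals supported on `σ`. -/
def SmallOn {b : SchauderBasis ℝ E} (φ : DSpace b →L[ℝ] ℝ) (ε : ℝ) (σ : Set Node) : Prop :=
  ∀ g : DSpace b, SupportedOn g σ → |φ g| ≤ ε * ‖g‖

/-- Unconditionality makes both restrictions of `g`, to `σ` and to its complement, contractive.
Since `φ` need not be weak* continuous, only finite unions can be treated like this. -/
theorem SmallOn.union {b : SchauderBasis ℝ E} (hb : IsUnconditional b) {φ : DSpace b →L[ℝ] ℝ}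
    {ε₁ ε₂ : ℝ} (h₁ : 0 ≤ ε₁) (h₂ : 0 ≤ ε₂) {σ τ : Set Node} (hσ : SmallOn φ ε₁ σ)
    (hτ : SmallOn φ ε₂ τ) : SmallOn φ (ε₁ + ε₂) (σ ∪ τ) := by
  intro g hg
  have h : g = restrD b σ g + restrD b σᶜ g := DSpace.ext_e fun t => by
    rw [add_apply, restrD_e hb, restrD_e hb]
    by_cases ht : t ∈ σ <;> simp [ht]
  have hl := hσ (restrD b σ g) fun t ht => by rw [restrD_e hb, if_neg ht]
  have hr := hτ (restrD b σᶜ g) fun t ht => by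
    rw [restrD_e hb]
    split_ifs with hs
    · exact hg t fun h => h.elim hs ht
    · rfl
  have hl' := mul_le_mul_of_nonneg_left (norm_restrD_apply_le hb σ g) h₁
  have hr' := mul_le_mul_of_nonneg_left (norm_restrD_apply_le hb σᶜ g) h₂
  conv_lhs => rw [h, map_add]
  refine (abs_add_le _ _).trans ?_
  linarith

theorem SmallOn.biUnion {b : SchauderBasis ℝ E} (hb : IsUnconditional b) {φ : DSpace b →L[ℝ] ℝ}
    {ε : ℝ} (hε : 0 ≤ ε) {ι : Type*} (F : Finset ι) {σ : ι → Set Node}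
    (h : ∀ i ∈ F, SmallOn φ ε (σ i)) : SmallOn φ (F.card * ε) (⋃ i ∈ F, σ i) := by
  classical
  induction F using Finset.induction_on with
  | empty =>
    intro g hg
    have : g = 0 := DSpace.ext_e fun t => by simpa using hg t (by simp)
    simp [this]
  | insert i F hi ih =>
    rw [Finset.set_biUnion_insert, Finset.card_insert_of_notMem hi]
    have := (h i (Finset.mem_insert_self _ _)).union hb hε (by positivity)
      (ih fun j hj => h j (Finset.mem_insert_of_mem hj))
    convert this using 1
    push_cast
    ring

theorem SmallOn.mono_set {b : SchauderBasis ℝ E} {φ : DSpace b →L[ℝ] ℝ}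
    {ε : ℝ} {σ τ : Set Node} (h : SmallOn φ ε τ) (hσ : σ ⊆ τ) : SmallOn φ ε σ :=
  fun g hg => h g fun t ht => hg t fun h' => ht (hσ h')

/-! ### Consequences of the non-`c₀` condition -/

theorem Incomparable.disjoint {A B : Set Node} (h : Incomparable A B) : Disjoint A B :=
  Set.disjoint_left.2 fun t hA hB => (h t hA t hB).1 (List.prefix_refl t)

theorem supp_synth (b : SchauderBasis ℝ E) (a : Node →₀ ℝ) :
    supp b (synth b a) = {t | a t ≠ 0} := by
  ext t; simp [supp, coord_synth]

theorem IncomparablyNonC0.exists_sum_le {b : SchauderBasis ℝ E} (hE : IncomparablyNonC0 b)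
    {σ : ℕ → Set Node} (hσ : ∀ j k, j ≠ k → Incomparable (σ j) (σ k)) {ε : ℝ} (hε : 0 < ε) :
    ∃ (N : ℕ) (a : Fin N → ℝ), ∑ j, |a j| = 1 ∧
      ∀ (A : Set Node), IsTreeAntichain A → ∀ z : Fin N → E,
        (∀ j, supp b (z j) ⊆ σ j ∩ A) → ‖∑ j, z j‖ = 1 → ∑ j, |a j| * ‖z j‖ ≤ ε := by
  have h : _ < ENNReal.ofReal ε := (hE σ hσ).trans_lt (ENNReal.ofReal_pos.2 hε)
  simp only [iInf_lt_iff] at h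
  obtain ⟨N, a, ha, h⟩ := h
  refine ⟨N, a, ha, fun A hA z hz h1 => (ENNReal.ofReal_le_ofReal_iff hε.le).1 ?_⟩
  refine le_trans ?_ h.le
  exact le_iSup_of_le A (le_iSup_of_le hA (le_iSup_of_le z (le_iSup_of_le hz
    (le_iSup_of_le h1 le_rfl))))

theorem synth_injective (b : SchauderBasis ℝ E) : Function.Injective (synth b) := by
  intro x y h
  ext t
  rw [← coord_synth b x, h, coord_synth]

/-- The estimate for restrictions to incomparable sets that the non-`c₀` condition
gives. -/
theorem IncomparablyNonC0.exists_sum_norm_mult_le {b : SchauderBasis ℝ E}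
    (hE : IncomparablyNonC0 b) {σ : ℕ → Set Node}
    (hσ : ∀ j k, j ≠ k → Incomparable (σ j) (σ k)) {ε : ℝ} (hε : 0 < ε) :
    ∃ (N : ℕ) (a : Fin N → ℝ), ∑ j, |a j| = 1 ∧
      ∀ x : C00 b, ∑ j, |a j| * ‖mult b ((σ j).indicator 1) x‖ ≤ 2 * ε * ‖x‖ := by
  obtain ⟨N, a, ha, h⟩ := hE.exists_sum_le hσ hε
  refine ⟨N, a, ha, fun x => ?_⟩
  -- Almost norming antichains for the separate pieces; incomparability of the `σ j` makes the union
  -- `B` of their traces a single antichain.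
  choose A hA hle using fun j : Fin N =>
    exists_norm_le_two_mul_norm_restr b (mult b ((σ j).indicator 1) x)
  let B : Set Node := ⋃ j : Fin N, A j ∩ σ j
  have hB : IsTreeAntichain B := by
    intro s hs t ht hst
    obtain ⟨j, hsA, hsσ⟩ := Set.mem_iUnion.1 hs
    obtain ⟨k, htA, htσ⟩ := Set.mem_iUnion.1 ht
    by_cases hjk : j = k
    · subst hjk
      exact hA j hsA htA hst
    · exact (hσ j k (fun h => hjk (Fin.ext h)) s hsσ t htσ).1
  let c : Fin N → Node →₀ ℝ := fun j => mulCoeff ((A j ∩ σ j).indicator 1) x.toFinsupp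
  let z : Fin N → E := fun j => synth b (c j)
  have hz : ∀ j, restr b (A j) (mult b ((σ j).indicator 1) x) = z j := by
    intro j
    rw [restr_mult]
    refine congrArg (synth b) ?_
    ext t
    by_cases h1 : t ∈ A j <;> by_cases h2 : t ∈ σ j <;> simp [c, h1, h2]
  have hsupp : ∀ j, supp b (z j) ⊆ σ j ∩ B := by
    intro j t ht
    rw [supp_synth] at ht
    have h0 : t ∈ A j ∩ σ j := by
      by_contra h0
      exact ht (by simp [c, h0])
    exact ⟨h0.2, Set.mem_iUnion.2 ⟨j, h0⟩⟩
  have hsum : ∑ j, z j = restr b B x := by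
    rw [restr_eq_synth, ← map_sum]
    refine congrArg (synth b) ?_
    ext t
    rw [Finsupp.finsetSum_apply]
    by_cases hB' : t ∈ B
    · obtain ⟨j, hj⟩ := Set.mem_iUnion.1 hB'
      rw [Finset.sum_eq_single j]
      · simp [c, hB', hj]
      · intro k _ hk
        have : t ∉ σ k := fun h' => (hσ k j (fun h => hk (Fin.ext h))).disjoint.le_bot ⟨h', hj.2⟩
        simp [c, this]
      · simp
    · have : ∀ j, t ∉ A j ∩ σ j := fun j hj => hB' (Set.mem_iUnion.2 ⟨j, hj⟩)
      simp [c, hB', this]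
  have key : ∑ j, |a j| * ‖z j‖ ≤ ε * ‖∑ j, z j‖ := by
    -- The condition speaks of sums of norm 1, so one normalizes; if the sum is zero, disjointness
    -- of supports makes every `z j` zero.
    rcases eq_or_ne (∑ j, z j) 0 with h0 | h0
    · have hz0 : ∀ j, z j = 0 := by
        rw [hsum, restr_eq_synth, ← map_zero (synth b)] at h0
        have h0 := synth_injective b h0
        intro j
        have : c j = 0 := by
          ext t
          have h1 := DFunLike.congr_fun h0 t
          by_cases ht : t ∈ A j ∩ σ j
          · have : t ∈ B := Set.mem_iUnion.2 ⟨j, ht⟩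
            simpa [c, ht, this] using h1
          · simp [c, ht]
        simp [z, this]
      simp [hz0]
    · have hr : 0 < ‖∑ j, z j‖ := norm_pos_iff.2 h0
      have := h B hB (fun j => ‖∑ j, z j‖⁻¹ • z j) (fun j t ht => hsupp j ?_) ?_
      · simp only [norm_smul, norm_inv, norm_norm] at this
        calc ∑ j, |a j| * ‖z j‖
            = ‖∑ j, z j‖ * ∑ j, |a j| * (‖∑ j, z j‖⁻¹ * ‖z j‖) := by
              rw [Finset.mul_sum]
              refine Finset.sum_congr rfl fun j _ => ?_
              field_simp
          _ ≤ ‖∑ j, z j‖ * ε := mul_le_mul_of_nonneg_left this hr.le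
          _ = _ := mul_comm _ _
      · intro h'
        exact ht (by simp [h'])
      · rw [← Finset.smul_sum, norm_smul, norm_inv, norm_norm, inv_mul_cancel₀ hr.ne']
  calc ∑ j, |a j| * ‖mult b ((σ j).indicator 1) x‖ ≤ ∑ j, |a j| * (2 * ‖z j‖) :=
        Finset.sum_le_sum fun j _ =>
          mul_le_mul_of_nonneg_left ((hle j).trans_eq (by rw [hz])) (abs_nonneg _)
    _ = 2 * ∑ j, |a j| * ‖z j‖ := by
        rw [Finset.mul_sum]
        exact Finset.sum_congr rfl fun j _ => by ring
    _ ≤ 2 * (ε * ‖x‖) := by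
        refine mul_le_mul_of_nonneg_left (key.trans ?_) zero_le_two
        rw [hsum]
        exact mul_le_mul_of_nonneg_left (norm_restr_le b hB x) hε.le
    _ = _ := by ring

/-- Among infinitely many pairwise incomparable sets, a functional on `D^E` is small on one. -/
theorem exists_smallOn {b : SchauderBasis ℝ E} (hb : IsUnconditional b)
    (hE : IncomparablyNonC0 b) (φ : DSpace b →L[ℝ] ℝ) {ε : ℝ} (hε : 0 < ε) {σ : ℕ → Set Node}
    (hσ : ∀ j k, j ≠ k → Incomparable (σ j) (σ k)) : ∃ j, SmallOn φ ε (σ j) := by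
  by_contra! hcon
  have hex : ∀ j, ∃ g : DSpace b, SupportedOn g (σ j) ∧ φ g = 1 ∧ ‖g‖ ≤ ε⁻¹ := by
    intro j
    have := hcon j
    simp only [SmallOn, not_forall, not_le] at this
    obtain ⟨g, hg, hlt⟩ := this
    have hφ : φ g ≠ 0 := by
      intro h
      rw [h, abs_zero] at hlt
      exact absurd hlt (not_lt.2 (by positivity))
    refine ⟨(φ g)⁻¹ • g, fun t ht => ?_, ?_, ?_⟩
    · simp [hg t ht]
    · simp [hφ]
    · have hpos : 0 < |φ g| := abs_pos.2 hφ
      rw [norm_smul, norm_inv, Real.norm_eq_abs, inv_mul_le_iff₀ hpos, ← div_eq_mul_inv,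
        le_div_iff₀ hε, mul_comm]
      exact hlt.le
  choose g hsupp hone hnorm using hex
  have hK : 0 < ‖φ‖ + 1 := by positivity
  -- The tolerance cancels the 2 of the estimate and the `ε⁻¹` bounding `‖g j‖`; the `+ 1` leaves a
  -- strict contradiction and covers `φ = 0`.
  obtain ⟨N, a, ha, h⟩ := hE.exists_sum_norm_mult_le hσ
    (show 0 < ε / (2 * (‖φ‖ + 1)) by positivity)
  have hG : ‖∑ j, |a j| • g j‖ ≤ (‖φ‖ + 1)⁻¹ := by
    refine norm_le_of_forall_coe (by positivity) fun x => ?_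
    calc |(∑ j : Fin N, |a j| • g j) (x : SSpace b)|
        = |∑ j : Fin N, |a j| * g j (x : SSpace b)| := by simp [sum_apply]
      _ ≤ ∑ j : Fin N, |a j| * (ε⁻¹ * ‖mult b ((σ j).indicator 1) x‖) := by
          refine (Finset.abs_sum_le_sum_abs _ _).trans (Finset.sum_le_sum fun j _ => ?_)
          rw [abs_mul, abs_abs, (hsupp j).apply_coe hb]
          refine mul_le_mul_of_nonneg_left ?_ (abs_nonneg _)
          have := (g j).le_of_opNorm_le (hnorm j) (mult b ((σ j).indicator 1) x : SSpace b)
          rwa [Completion.norm_coe, Real.norm_eq_abs] at this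
      _ = ε⁻¹ * ∑ j : Fin N, |a j| * ‖mult b ((σ j).indicator 1) x‖ := by
          rw [Finset.mul_sum]
          exact Finset.sum_congr rfl fun j _ => by ring
      _ ≤ ε⁻¹ * (2 * (ε / (2 * (‖φ‖ + 1))) * ‖x‖) :=
          mul_le_mul_of_nonneg_left (h x) (by positivity)
      _ = (‖φ‖ + 1)⁻¹ * ‖x‖ := by field_simp
  have h1 : φ (∑ j, |a j| • g j) = 1 := by
    simp [map_sum, hone, ha]
  have h2 := φ.le_opNorm (∑ j, |a j| • g j)
  rw [h1, norm_one] at h2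
  have h3 : ‖φ‖ * ‖∑ j, |a j| • g j‖ ≤ ‖φ‖ * (‖φ‖ + 1)⁻¹ :=
    mul_le_mul_of_nonneg_left hG φ.opNorm_nonneg
  have h4 : ‖φ‖ * (‖φ‖ + 1)⁻¹ < 1 := by
    rw [← div_eq_mul_inv, div_lt_one hK]
    linarith
  linarith

/-! ### Cones and branches -/

/-- The cone of all nodes above `w`. -/
def cone (w : Node) : Set Node := {t | w <+: t}

theorem not_prefix_of_append_ne {w s t : Node} {x y : Bool} (hxy : x ≠ y)
    (hs : w ++ [x] <+: s) (ht : w ++ [y] <+: t) : ¬ s <+: t := by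
  intro hst
  have h1 := List.prefix_of_prefix_length_le (hs.trans hst) ht (by simp)
  have h2 := h1.eq_of_length (by simp)
  simp at h2
  exact hxy h2

theorem incomparable_cone {w v₁ v₂ : Node} {x y : Bool} (hxy : x ≠ y)
    (h₁ : w ++ [x] <+: v₁) (h₂ : w ++ [y] <+: v₂) : Incomparable (cone v₁) (cone v₂) :=
  fun _ hs _ ht => ⟨not_prefix_of_append_ne hxy (h₁.trans hs) (h₂.trans ht),
    not_prefix_of_append_ne hxy.symm (h₂.trans ht) (h₁.trans hs)⟩

/-- The teeth of a comb: the `j`-th cone leaves the leftmost branch above `w` after `j` steps, where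
the later ones still follow it. -/
theorem incomparable_cone_comb (w : Node) {j k : ℕ} (hjk : j < k) :
    Incomparable (cone (w ++ List.replicate j false ++ [true]))
      (cone (w ++ List.replicate k false ++ [true])) := by
  refine incomparable_cone (w := w ++ List.replicate j false) (x := true) (y := false) (by simp)
    (List.prefix_refl _) ?_
  obtain ⟨i, rfl⟩ : ∃ i, k = j + 1 + i := ⟨k - (j + 1), by omega⟩
  refine ⟨List.replicate i false ++ [true], ?_⟩
  simp [List.replicate_add, List.append_assoc]

theorem Incomparable.symm {A B : Set Node} (h : Incomparable A B) : Incomparable B A :=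
  fun s hs t ht => (h t ht s hs).symm

/-- Every cone contains a cone on which a given functional on `D^E` is small. -/
theorem exists_smallOn_cone {b : SchauderBasis ℝ E} (hb : IsUnconditional b)
    (hE : IncomparablyNonC0 b) (φ : DSpace b →L[ℝ] ℝ) {ε : ℝ} (hε : 0 < ε) (w : Node) :
    ∃ v, w <+: v ∧ SmallOn φ ε (cone v) := by
  obtain ⟨j, hj⟩ := exists_smallOn hb hE φ hε
    (σ := fun j => cone (w ++ List.replicate j false ++ [true])) fun j k hjk => by
      rcases lt_or_gt_of_ne hjk with h | h
      · exact incomparable_cone_comb w h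
      · exact (incomparable_cone_comb w h).symm
  exact ⟨_, ⟨List.replicate j false ++ [true], by simp⟩, hj⟩

theorem exists_number_eq (n : ℕ) : ∃ t : Node, t.number = n := Node.number_bijective.2 n

theorem norm_vec {b : SchauderBasis ℝ E} (hb : IsSpreading b) (t : Node) :
    ‖vec b t‖ = ‖vec b []‖ := by
  choose r hr using exists_number_eq
  -- Shifting the numbering by `t.number` is increasing and carries the root to `t`.
  have h := hb (fun s => r (s.number + t.number)) (fun t₁ t₂ h12 => by
    rw [← Node.number_lt_iff, hr, hr]
    exact Nat.add_lt_add_right (Node.number_lt_iff.2 h12) _) (Finsupp.single [] 1)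
  rw [Finsupp.sum_single_index (by simp), Finsupp.sum_single_index (by simp)] at h
  have h0 : r (Node.number [] + t.number) = t :=
    Node.number_bijective.1 (by rw [hr]; simp [Node.number])
  rw [h0] at h
  simpa using h.symm

/-- A vector supported on a chain has the norm of `c₀`. -/
theorem norm_le_of_chain {b : SchauderBasis ℝ E} (hb : IsSpreading b) (x : C00 b)
    (hx : ∀ s t, x.toFinsupp s ≠ 0 → x.toFinsupp t ≠ 0 → s <+: t ∨ t <+: s)
    (h1 : ∀ t, |x.toFinsupp t| ≤ 1) : ‖x‖ ≤ ‖vec b []‖ := by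
  refine norm_le_of_restr fun A hA => ?_
  rw [restr_eq_synth]
  -- An antichain meets a chain in at most one node, so the restriction has at most one term.
  by_cases h : ∃ s ∈ A, x.toFinsupp s ≠ 0
  · obtain ⟨s, hsA, hs⟩ := h
    have : mulCoeff (A.indicator 1) x.toFinsupp = Finsupp.single s (x.toFinsupp s) := by
      ext t
      by_cases hts : t = s
      · subst hts; simp [hsA]
      · rw [Finsupp.single_eq_of_ne hts, mulCoeff_apply]
        by_cases htA : t ∈ A
        · by_cases ht : x.toFinsupp t = 0
          · simp [ht]
          · rcases hx s t hs ht with h' | h'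
            · exact absurd h' (hA hsA htA (Ne.symm hts))
            · exact absurd h' (hA htA hsA hts)
        · simp [htA]
    rw [this]
    refine (congrArg norm (Finsupp.linearCombination_single ℝ (x.toFinsupp s) s)).trans_le ?_
    rw [norm_smul, norm_vec hb, Real.norm_eq_abs]
    exact mul_le_of_le_one_left (norm_nonneg _) (h1 s)
  · push Not at h
    have : mulCoeff (A.indicator 1) x.toFinsupp = 0 := by
      ext t
      by_cases htA : t ∈ A
      · simp [h t htA]
      · simp [htA]
    rw [this, map_zero, norm_zero]
    exact norm_nonneg _

/-- Test `h` on the vector of its own signs along the branch, whose norm `norm_le_of_chain` bounds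
independently of `F`. -/
theorem sum_abs_branch_le {b : SchauderBasis ℝ E} (hb : IsSpreading b) (h : DSpace b) (w : Node)
    (F : Finset ℕ) :
    ∑ k ∈ F, |h (e b (w ++ List.replicate k false))| ≤ ‖h‖ * ‖vec b []‖ := by
  classical
  let v : ℕ → Node := fun k => w ++ List.replicate k false
  have hv : Function.Injective v := fun j k hjk => by
    have := congrArg List.length hjk
    simpa [v] using this
  let a : Node →₀ ℝ := ∑ k ∈ F, Finsupp.single (v k) (SignType.sign (h (e b (v k))) : ℝ)
  let x : C00 b := C00.ofFinsupp b a
  have ha : ∀ t, a t ≠ 0 → ∃ k ∈ F, v k = t := by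
    intro t ht
    by_contra! hne
    refine ht ?_
    rw [Finsupp.finsetSum_apply]
    exact Finset.sum_eq_zero fun k hk => Finsupp.single_eq_of_ne (hne k hk).symm
  have hav : ∀ k ∈ F, a (v k) = SignType.sign (h (e b (v k))) := by
    intro k hk
    rw [Finsupp.finsetSum_apply, Finset.sum_eq_single k]
    · simp
    · intro j _ hj
      exact Finsupp.single_eq_of_ne fun h' => hj (hv h').symm
    · intro h'; exact absurd hk h'
  have hx : ‖x‖ ≤ ‖vec b []‖ := by
    refine norm_le_of_chain hb x (fun s t hs ht => ?_) fun t => ?_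
    · obtain ⟨j, _, rfl⟩ := ha s hs
      obtain ⟨k, _, rfl⟩ := ha t ht
      rcases le_total j k with hjk | hjk
      · left
        exact (List.prefix_append_right_inj w).2 (by simpa [List.prefix_replicate_iff] using hjk)
      · right
        exact (List.prefix_append_right_inj w).2 (by simpa [List.prefix_replicate_iff] using hjk)
    · change |a t| ≤ 1
      by_cases ht : a t = 0
      · simp [ht]
      · obtain ⟨k, hk, rfl⟩ := ha t ht
        rw [hav k hk]
        rcases lt_trichotomy (h (e b (v k))) 0 with h' | h' | h' <;> simp [h']
  have hsum : h (x : SSpace b) = ∑ k ∈ F, |h (e b (v k))| := by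
    rw [apply_coe_eq_sum]
    change (a.sum fun t r => r * h (e b t)) = _
    rw [← Finsupp.sum_finsetSum_index (by simp) (by intros; ring)]
    refine Finset.sum_congr rfl fun k _ => ?_
    rw [Finsupp.sum_single_index (by simp), sign_mul_self]
  rw [← hsum]
  refine (le_abs_self _).trans ((h.le_opNorm _).trans ?_)
  rw [Completion.norm_coe]
  exact mul_le_mul_of_nonneg_left hx (norm_nonneg _)

open Filter Topology in
theorem tendsto_branch {b : SchauderBasis ℝ E} (hb : IsSpreading b) (h : DSpace b) (w : Node) :
    Tendsto (fun k => |h (e b (w ++ List.replicate k false))|) atTop (𝓝 0) :=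
  (summable_of_sum_le (fun _ => abs_nonneg _) (sum_abs_branch_le hb h w)).tendsto_atTop_zero

/-- Every cone contains an arbitrarily long node at which finitely many functionals are small. -/
theorem exists_deep_node {b : SchauderBasis ℝ E} (hb : IsSpreading b) {ι : Type*} (F : Finset ι)
    (h : ι → DSpace b) (l : ι → ℕ) {ε : ℝ} (hε : 0 < ε) (w : Node) :
    ∃ t, w <+: t ∧ ∀ i ∈ F, |h i (e b t)| ≤ ε ∧ l i < t.length := by
  have h1 : ∀ᶠ k in Filter.atTop, ∀ i ∈ F, |h i (e b (w ++ List.replicate k false))| ≤ ε ∧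
      l i < (w ++ List.replicate k false).length := by
    rw [Filter.eventually_all_finset]
    intro i _
    filter_upwards [(tendsto_branch hb (h i) w).eventually_le_const hε,
      Filter.eventually_gt_atTop (l i)] with k hk hk'
    refine ⟨hk, ?_⟩
    simp
    omega
  obtain ⟨k, hk⟩ := h1.exists
  exact ⟨_, List.prefix_append _ _, hk⟩

/-! ### Choosing the subtree -/

/-- The functional `g ↦ ⟨e_x, T g⟩`. -/
def entry {b : SchauderBasis ℝ E} (T : DSpace b →L[ℝ] DSpace b) (x : Node) : DSpace b →L[ℝ] ℝ :=
  (ContinuousLinearMap.apply ℝ ℝ (e b x)).comp T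

theorem norm_e {b : SchauderBasis ℝ E} (hb : IsSpreading b) (t : Node) :
    ‖e b t‖ ≤ ‖vec b []‖ := by
  rw [e, Completion.norm_coe]
  have hs : ∀ s, (Finsupp.single t (1 : ℝ)) s ≠ 0 → t = s := fun s hs => by
    by_contra h
    exact hs (Finsupp.single_eq_of_ne (Ne.symm h))
  refine norm_le_of_chain hb _ (fun s r hs' hr' => ?_) fun s => ?_
  · left
    rw [← hs s hs', ← hs r hr']
  · change |(Finsupp.single t (1 : ℝ)) s| ≤ 1
    rw [Finsupp.single_apply]
    split_ifs <;> simp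

theorem eq_smul_f_of_supportedOn_singleton {b : SchauderBasis ℝ E} {g : DSpace b} {v : Node}
    (hg : SupportedOn g {v}) : g = g (e b v) • f b v := DSpace.ext_e fun t => by
  rw [smul_apply, f_e]
  by_cases h : v = t
  · subst h; simp
  · simp [h, hg t (fun h' => h h'.symm)]

/-- A functional supported at `v` is a multiple of `f b v`, with coefficient at most `‖g‖ * ‖vec b
[]‖`; hence the division. -/
theorem smallOn_singleton {b : SchauderBasis ℝ E} (hb : IsSpreading b) {φ : DSpace b →L[ℝ] ℝ}
    {ε : ℝ} {v : Node} (h : |φ (f b v)| ≤ ε / ‖vec b []‖) : SmallOn φ ε {v} := by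
  intro g hg
  have hc : 0 < ‖vec b []‖ := norm_pos_iff.2 (vec_ne_zero b [])
  have h1 : |g (e b v)| ≤ ‖g‖ * ‖vec b []‖ :=
    (g.le_opNorm _).trans (mul_le_mul_of_nonneg_left (norm_e hb v) (norm_nonneg _))
  rw [eq_smul_f_of_supportedOn_singleton hg, map_smul, smul_eq_mul, abs_mul,
    ← eq_smul_f_of_supportedOn_singleton hg]
  calc |g (e b v)| * |φ (f b v)| ≤ (‖g‖ * ‖vec b []‖) * (ε / ‖vec b []‖) :=
        mul_le_mul h1 h (abs_nonneg _) (by positivity)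
    _ = ε * ‖g‖ := by field_simp

/-- A stage of the construction of a subtree: the roots `W m` of the cones from which the node
with number `m` will be taken, the set `H` of the nodes chosen so far and the last of them. -/
structure Stage where
  /-- Roots of the remaining cones. -/
  W : ℕ → Node
  /-- Nodes chosen so far. -/
  H : Finset Node
  /-- The last node chosen. -/
  x : Node

/-- `S'` is obtained from `S` by choosing the node with number `n`. -/
structure Stage.IsNext {b : SchauderBasis ℝ E} (T : DSpace b →L[ℝ] DSpace b) (ε : ℝ) (n : ℕ)
    (S S' : Stage) : Prop where
  mem_cone : S.W n <+: S'.x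
  small_singleton : ∀ v ∈ S.H, SmallOn (entry T S'.x) ε {v}
  length_lt : ∀ v ∈ S.H, v.length < S'.x.length
  insert_eq : S'.H = insert S'.x S.H
  -- Only the two slots of the children are reset, to lie above the new node; their previous
  -- contents do not matter.
  shrink : ∀ m, m ≠ 2 * n + 1 → m ≠ 2 * n + 2 → S.W m <+: S'.W m
  left : S'.x ++ [false] <+: S'.W (2 * n + 1)
  right : S'.x ++ [true] <+: S'.W (2 * n + 2)
  small_cone : ∀ m, SmallOn (entry T S'.x) ε (cone (S'.W m))

/-- The new node is taken deep on a branch, so that its entries against earlier nodes are small;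
then every cone is shrunk to make its row small there. -/
theorem Stage.exists_isNext {b : SchauderBasis ℝ E} (hb : IsSubsymmetric b)
    (hE : IncomparablyNonC0 b) (T : DSpace b →L[ℝ] DSpace b) {ε : ℝ} (hε : 0 < ε) (n : ℕ)
    (S : Stage) : ∃ S', Stage.IsNext T ε n S S' := by
  have hc : 0 < ‖vec b []‖ := norm_pos_iff.2 (vec_ne_zero b [])
  obtain ⟨x, hx, hxH⟩ := exists_deep_node hb.2 S.H (fun v => T (f b v)) List.length
    (div_pos hε hc) (S.W n)
  choose sh hsh hsmall using exists_smallOn_cone hb.1 hE (entry T x) hε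
  let V : ℕ → Node := fun m =>
    if m = 2 * n + 1 then x ++ [false] else if m = 2 * n + 2 then x ++ [true] else S.W m
  refine ⟨⟨fun m => sh (V m), insert x S.H, x⟩, hx,
    fun v hv => smallOn_singleton hb.2 (hxH v hv).1, fun v hv => (hxH v hv).2, rfl,
    fun m h1 h2 => ?_, ?_, ?_, fun m => hsmall _⟩
  · have : V m = S.W m := by simp [V, h1, h2]
    simpa [this] using hsh (V m)
  · simpa [V] using hsh (V (2 * n + 1))
  · simpa [V] using hsh (V (2 * n + 2))

/-- There is a copy of the tree on which the matrix of `T` is a small perturbation of its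
diagonal. -/
theorem exists_subtree {b : SchauderBasis ℝ E} (hb : IsSubsymmetric b)
    (hE : IncomparablyNonC0 b) (T : DSpace b →L[ℝ] DSpace b) {ε : ℕ → ℝ} (hε : ∀ n, 0 < ε n) :
    ∃ s : ℕ → Node, (∀ i n, i < n → (s i).length < (s n).length) ∧
      (∀ n, s n ++ [false] <+: s (2 * n + 1)) ∧ (∀ n, s n ++ [true] <+: s (2 * n + 2)) ∧
      ∀ n, SmallOn (entry T (s n)) (ε n) {t | ∃ m, m ≠ n ∧ s m = t} := by
  -- Row `n` is estimated on `n` earlier singletons and `n + 2` cones, which share the tolerance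
  -- equally.
  have hε' : ∀ n, 0 < ε n / ((2 * n + 2 : ℕ) : ℝ) := fun n => div_pos (hε n) (by positivity)
  choose next hnext using fun n => Stage.exists_isNext hb hE T (hε' n) n
  let S : ℕ → Stage := fun n => Nat.rec ⟨fun _ => [], ∅, []⟩ (fun n S => next n S) n
  have hS : ∀ n, Stage.IsNext T (ε n / ((2 * n + 2 : ℕ) : ℝ)) n (S n) (S (n + 1)) :=
    fun n => hnext n (S n)
  -- Stage 0 carries a dummy node; the node with number `n` first appears in stage `n + 1`.
  let s : ℕ → Node := fun n => (S (n + 1)).x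
  have hH : ∀ n i, i < n → s i ∈ (S n).H := by
    intro n
    induction n with
    | zero => intro i hi; omega
    | succ n ih =>
      intro i hi
      rw [(hS n).insert_eq, Finset.mem_insert]
      rcases Nat.lt_succ_iff_lt_or_eq.1 hi with h | rfl
      · exact Or.inr (ih i h)
      · exact Or.inl rfl
  -- From stage `k` on only slots above `2 * k` are reset, so slot `m` merely shrinks.
  have hW : ∀ m k, m ≤ 2 * k → ∀ j, (S k).W m <+: (S (k + j)).W m := by
    intro m k hk j
    induction j with
    | zero => exact List.prefix_refl _
    | succ j ih => exact ih.trans ((hS (k + j)).shrink m (by omega) (by omega))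
  have hWs : ∀ m k, m ≤ 2 * k → k ≤ m → (S k).W m <+: s m := by
    intro m k hk hkm
    have := hW m k hk (m - k)
    rw [Nat.add_sub_cancel' hkm] at this
    exact this.trans (hS m).mem_cone
  have hl : ∀ n, s n ++ [false] <+: s (2 * n + 1) := fun n =>
    (hS n).left.trans (hWs (2 * n + 1) (n + 1) (by omega) (by omega))
  have hr : ∀ n, s n ++ [true] <+: s (2 * n + 2) := fun n =>
    (hS n).right.trans (hWs (2 * n + 2) (n + 1) (by omega) (by omega))
  refine ⟨s, fun i n hi => (hS n).length_lt _ (hH n i hi), hl, hr, fun n => ?_⟩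
  -- Infinitely many later nodes lie in finitely many cones: descend to the parent `(u - 1) / 2`
  -- until the number is at most `2 * n + 2`.
  have hcone : ∀ u, n + 1 ≤ u → ∃ m ∈ Finset.Icc (n + 1) (2 * n + 2),
      s u ∈ cone ((S (n + 1)).W m) := by
    intro u
    induction u using Nat.strong_induction_on with
    | _ u ih =>
      intro hu
      by_cases hle : u ≤ 2 * n + 2
      · exact ⟨u, Finset.mem_Icc.2 ⟨hu, hle⟩, hWs u (n + 1) (by omega) hu⟩
      · obtain ⟨m, hm, hmem⟩ := ih ((u - 1) / 2) (by omega) (by omega)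
        refine ⟨m, hm, List.IsPrefix.trans hmem ?_⟩
        rcases Nat.mod_two_eq_zero_or_one u with h | h
        · have := hr ((u - 1) / 2)
          rw [show 2 * ((u - 1) / 2) + 2 = u by omega] at this
          exact (List.prefix_append _ _).trans this
        · have := hl ((u - 1) / 2)
          rw [show 2 * ((u - 1) / 2) + 1 = u by omega] at this
          exact (List.prefix_append _ _).trans this
  have h1 := SmallOn.biUnion hb.1 (hε' n).le (Finset.range n) (σ := fun i => {s i})
    fun i hi => (hS n).small_singleton _ (hH n i (Finset.mem_range.1 hi))
  have h2 := SmallOn.biUnion hb.1 (hε' n).le (Finset.Icc (n + 1) (2 * n + 2))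
    fun m _ => (hS n).small_cone m
  have h3 := h1.union hb.1 (mul_nonneg (by positivity) (hε' n).le)
    (mul_nonneg (by positivity) (hε' n).le) h2
  have hcard : ((Finset.range n).card : ℝ) * (ε n / ((2 * n + 2 : ℕ) : ℝ)) +
      ((Finset.Icc (n + 1) (2 * n + 2)).card : ℝ) * (ε n / ((2 * n + 2 : ℕ) : ℝ)) = ε n := by
    rw [← add_mul, ← Nat.cast_add, Finset.card_range, Nat.card_Icc,
      show n + (2 * n + 2 + 1 - (n + 1)) = 2 * n + 2 by omega, mul_div_cancel₀]
    positivity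
  rw [hcard] at h3
  refine h3.mono_set ?_
  rintro _ ⟨m, hm, rfl⟩
  rcases lt_or_gt_of_ne hm with h | h
  · exact Or.inl (Set.mem_biUnion (Finset.mem_coe.2 (Finset.mem_range.2 h)) rfl)
  · obtain ⟨k, hk, hmem⟩ := hcone m h
    exact Or.inr (Set.mem_biUnion (Finset.mem_coe.2 hk) hmem)

/-! ### Embeddings of the tree -/

/-- An embedding of the tree into itself that respects both orders. -/
structure IsTreeEmbedding (s : Node → Node) : Prop where
  lt : ∀ t₁ t₂ : Node, t₁.LT t₂ → (s t₁).LT (s t₂)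
  child : ∀ (t : Node) (x : Bool), s t ++ [x] <+: s (t ++ [x])

theorem IsTreeEmbedding.injective {s : Node → Node} (hs : IsTreeEmbedding s) :
    Function.Injective s := by
  intro t u h
  rcases Node.LT_trichotomy t u with h' | h' | h'
  · have := Node.number_lt_of_LT (hs.lt _ _ h'); rw [h] at this; omega
  · exact h'
  · have := Node.number_lt_of_LT (hs.lt _ _ h'); rw [h] at this; omega

theorem IsTreeEmbedding.prefix {s : Node → Node} (hs : IsTreeEmbedding s) {t u : Node}
    (h : t <+: u) : s t <+: s u := by
  obtain ⟨r, rfl⟩ := h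
  induction r using List.reverseRecOn with
  | nil => simp
  | append_singleton r x ih =>
    rw [← List.append_assoc]
    exact ih.trans ((List.prefix_append _ _).trans (hs.child _ _))

theorem exists_split_of_not_prefix {t u : Node} (h1 : ¬ t <+: u) (h2 : ¬ u <+: t) :
    ∃ (w : Node) (x y : Bool), x ≠ y ∧ w ++ [x] <+: t ∧ w ++ [y] <+: u := by
  induction t generalizing u with
  | nil => exact absurd (List.nil_prefix) h1
  | cons a t ih =>
    cases u with
    | nil => exact absurd (List.nil_prefix) h2
    | cons c u =>
      by_cases hac : a = c
      · subst hac
        simp only [List.cons_prefix_cons, true_and] at h1 h2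
        obtain ⟨w, x, y, hxy, hx, hy⟩ := ih h1 h2
        exact ⟨a :: w, x, y, hxy, by simpa using hx, by simpa using hy⟩
      · exact ⟨[], a, c, hac, by simp, by simp⟩

/-- Incomparable nodes split at some `w`, and `child` makes their images split just above the image
of `w`. -/
theorem IsTreeEmbedding.prefix_iff {s : Node → Node} (hs : IsTreeEmbedding s) {t u : Node} :
    s t <+: s u ↔ t <+: u := by
  refine ⟨fun h => ?_, hs.prefix⟩
  by_contra h1
  by_cases h2 : u <+: t
  · have h3 := hs.prefix h2
    have h4 : s t = s u := h.eq_of_length (le_antisymm h.length_le h3.length_le)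
    rw [hs.injective h4] at h1
    exact h1 (List.prefix_refl _)
  · obtain ⟨w, x, y, hxy, hx, hy⟩ := exists_split_of_not_prefix h1 h2
    exact not_prefix_of_append_ne hxy ((hs.child w x).trans (hs.prefix hx))
      ((hs.child w y).trans (hs.prefix hy)) h

theorem number_append (t : Node) (x : Bool) :
    Node.number (t ++ [x]) = 2 * t.number + 1 + x.toNat := by
  simp [Node.number, List.foldl_append]

/-- Strictly increasing lengths already give the linear order. -/
theorem isTreeEmbedding_of_seq {s : ℕ → Node} (hlen : ∀ i n, i < n → (s i).length < (s n).length)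
    (hl : ∀ n, s n ++ [false] <+: s (2 * n + 1)) (hr : ∀ n, s n ++ [true] <+: s (2 * n + 2)) :
    IsTreeEmbedding fun t => s t.number where
  lt t₁ t₂ h := List.shortlex_def.2 (Or.inl (hlen _ _ (Node.number_lt_of_LT h)))
  child t x := by
    rw [number_append]
    cases x
    · exact hl _
    · exact hr _

section Embedding

variable {s : Node → Node}

/-- The map `e_t ↦ e_{s_t}` on `c₀₀`. -/
def push (b : SchauderBasis ℝ E) (s : Node → Node) : C00 b →ₗ[ℝ] C00 b :=
  (Finsupp.lmapDomain ℝ ℝ s : (Node →₀ ℝ) →ₗ[ℝ] (Node →₀ ℝ))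

/-- The map `a ↦ (a_{s_t})_t` on `c₀₀`. -/
def pull (b : SchauderBasis ℝ E) (hs : Function.Injective s) : C00 b →ₗ[ℝ] C00 b :=
  (Finsupp.lcomapDomain s hs : (Node →₀ ℝ) →ₗ[ℝ] (Node →₀ ℝ))

theorem norm_synth_mapDomain {b : SchauderBasis ℝ E} (hb : IsSpreading b)
    (hs : IsTreeEmbedding s) (a : Node →₀ ℝ) :
    ‖synth b (Finsupp.mapDomain s a)‖ = ‖synth b a‖ := by
  rw [synth_apply, synth_apply, hb s hs.lt a, Finsupp.sum_mapDomain_index (by simp)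
    (by intros; rw [add_smul])]

/-- Preimages of antichains under `s` are antichains, and spreading preserves the norm in `E`. -/
theorem norm_push_le {b : SchauderBasis ℝ E} (hb : IsSpreading b) (hs : IsTreeEmbedding s)
    (x : C00 b) : ‖push b s x‖ ≤ 1 * ‖x‖ := by
  rw [one_mul]
  refine norm_le_of_restr fun A hA => ?_
  have hA' : IsTreeAntichain (s ⁻¹' A) := fun t ht u hu htu h =>
    hA ht hu (fun h' => htu (hs.injective h')) (hs.prefix h)
  refine le_trans (le_of_eq ?_) (norm_restr_le b hA' x)
  rw [restr_eq_synth, restr_eq_synth, ← norm_synth_mapDomain hb hs (mulCoeff _ x.toFinsupp)]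
  refine congrArg (fun a => ‖synth b a‖) ?_
  change mulCoeff _ (Finsupp.mapDomain s x.toFinsupp) = _
  induction x.toFinsupp using Finsupp.induction_linear with
  | zero => simp
  | add y z hy hz => rw [Finsupp.mapDomain_add, map_add, map_add, hy, hz, Finsupp.mapDomain_add]
  | single t r =>
    rw [Finsupp.mapDomain_single, mulCoeff_single, mulCoeff_single, Finsupp.mapDomain_single]
    congr 1

/-- Images of antichains are antichains; this needs `s` to reflect the prefix order. -/
theorem norm_pull_le {b : SchauderBasis ℝ E} (hb : IsSpreading b) (hs : IsTreeEmbedding s)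
    (x : C00 b) : ‖pull b hs.injective x‖ ≤ 1 * ‖x‖ := by
  rw [one_mul]
  refine norm_le_of_restr fun A hA => ?_
  have hA' : IsTreeAntichain (s '' A) := by
    rintro _ ⟨t, ht, rfl⟩ _ ⟨u, hu, rfl⟩ htu h
    exact hA ht hu (fun h' => htu (by rw [h'])) (hs.prefix_iff.1 h)
  refine le_trans (le_of_eq ?_) (norm_restr_le b hA' x)
  rw [restr_eq_synth, restr_eq_synth, ← norm_synth_mapDomain hb hs]
  refine congrArg (fun a => ‖synth b a‖) ?_
  ext t
  by_cases ht : t ∈ Set.range s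
  · obtain ⟨u, rfl⟩ := ht
    rw [Finsupp.mapDomain_apply hs.injective, mulCoeff_apply, mulCoeff_apply]
    have h1 : (pull b hs.injective x).toFinsupp u = x.toFinsupp (s u) := rfl
    rw [h1]
    congr 1
    by_cases hu : u ∈ A
    · simp [hu, Set.mem_image_of_mem s hu]
    · have : s u ∉ s '' A := fun ⟨v, hv, h⟩ => hu (hs.injective h ▸ hv)
      simp [hu, this]
  · rw [Finsupp.mapDomain_of_notMem_range _ _ ht, mulCoeff_apply]
    have : t ∉ s '' A := fun ⟨v, _, h⟩ => ht ⟨v, h⟩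
    simp [this]

theorem pullback_push_e {b : SchauderBasis ℝ E} (hb : IsSpreading b) (hs : IsTreeEmbedding s)
    (g : DSpace b) (t : Node) : pullback (push b s) g (e b t) = g (e b (s t)) := by
  rw [e, pullback_coe (norm_push_le hb hs)]
  refine congrArg (fun a : Node →₀ ℝ => g ((C00.ofFinsupp b a : C00 b) : SSpace b)) ?_
  exact Finsupp.mapDomain_single

theorem pullback_pull_e {b : SchauderBasis ℝ E} (hb : IsSpreading b) (hs : IsTreeEmbedding s)
    (g : DSpace b) (t : Node) :
    pullback (pull b hs.injective) g (e b (s t)) = g (e b t) := by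
  rw [e, pullback_coe (norm_pull_le hb hs)]
  refine congrArg (fun a : Node →₀ ℝ => g ((C00.ofFinsupp b a : C00 b) : SSpace b)) ?_
  ext u
  change Finsupp.single (s t) (1 : ℝ) (s u) = Finsupp.single t (1 : ℝ) u
  simp [Finsupp.single_apply, hs.injective.eq_iff]

theorem supportedOn_pullback_pull {b : SchauderBasis ℝ E} (hb : IsSpreading b)
    (hs : IsTreeEmbedding s) (g : DSpace b) :
    SupportedOn (pullback (pull b hs.injective) g) (Set.range s) := by
  intro t ht
  rw [e, pullback_coe (norm_pull_le hb hs)]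
  have : pull b hs.injective (C00.ofFinsupp b (Finsupp.single t 1)) = 0 := by
    refine Finsupp.ext fun u => ?_
    change Finsupp.single t (1 : ℝ) (s u) = 0
    exact Finsupp.single_eq_of_ne fun h => ht ⟨u, h⟩
  rw [this, Completion.coe_zero, map_zero]

end Embedding

/-! ### Perturbation of the identity -/

theorem sum_half_pow_number_le (F : Finset Node) :
    ∑ t ∈ F, (1 / 2 : ℝ) ^ (t.number + 1) ≤ 1 := by
  have h : ∑ t ∈ F, (1 / 2 : ℝ) ^ (t.number + 1)
      = ∑ n ∈ F.image Node.number, (1 / 2 : ℝ) ^ (n + 1) :=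
    (Finset.sum_image (f := fun n => (1 / 2 : ℝ) ^ (n + 1)) fun _ _ _ _ h => Node.number_bijective.1 h).symm
  rw [h]
  have h2 : HasSum (fun n : ℕ => (1 / 2 : ℝ) ^ (n + 1)) 1 := by
    have := hasSum_geometric_two.mul_right (1 / 2 : ℝ)
    simpa [pow_succ] using this
  exact sum_le_hasSum _ (fun n _ => by positivity) h2

/-- Coordinates of `x` are at most `‖x‖ / ‖vec b []‖`, so coefficients with geometric decay give a
norm bound. -/
theorem norm_le_of_coeff_le {b : SchauderBasis ℝ E} (hb : IsSpreading b) {g : DSpace b} {M : ℝ}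
    (hM : 0 ≤ M) (h : ∀ t, |g (e b t)| ≤ M * ‖vec b []‖ * (1 / 2) ^ (t.number + 1)) :
    ‖g‖ ≤ M := by
  refine norm_le_of_forall_coe hM fun x => ?_
  have hc : 0 < ‖vec b []‖ := norm_pos_iff.2 (vec_ne_zero b [])
  rw [apply_coe_eq_sum, Finsupp.sum]
  calc |∑ t ∈ x.toFinsupp.support, x.toFinsupp t * g (e b t)|
      ≤ ∑ t ∈ x.toFinsupp.support, (M * ‖x‖) * (1 / 2 : ℝ) ^ (t.number + 1) := by
        refine (Finset.abs_sum_le_sum_abs _ _).trans (Finset.sum_le_sum fun t _ => ?_)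
        rw [abs_mul]
        have h1 := abs_apply_le b t x
        rw [norm_vec hb] at h1
        refine (mul_le_mul h1 (h t) (abs_nonneg _) (by positivity)).trans_eq ?_
        field_simp
    _ = (M * ‖x‖) * ∑ t ∈ x.toFinsupp.support, (1 / 2 : ℝ) ^ (t.number + 1) := by
        rw [Finset.mul_sum]
    _ ≤ M * ‖x‖ := mul_le_of_le_one_right (by positivity) (sum_half_pow_number_le _)

/-- An operator near the identity has a left inverse that is near the identity. -/
theorem exists_leftInverse_of_norm_sub_le {X : Type*} [NormedAddCommGroup X] [NormedSpace ℝ X]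
    [CompleteSpace X] (K : X →L[ℝ] X) {r : ℝ} (hr : r < 1)
    (hK : ‖ContinuousLinearMap.id ℝ X - K‖ ≤ r) :
    ∃ L : X →L[ℝ] X, L ∘L K = ContinuousLinearMap.id ℝ X ∧ ‖L‖ ≤ (1 - r)⁻¹ := by
  let R : X →L[ℝ] X := ContinuousLinearMap.id ℝ X - K
  have hR : ‖R‖ < 1 := hK.trans_lt hr
  have hL : (∑' n : ℕ, R ^ n) * (1 - R) = 1 := geom_series_mul_neg R hR
  have h1R : 1 - R = K := sub_sub_cancel _ _
  rw [h1R] at hL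
  refine ⟨∑' n : ℕ, R ^ n, hL, ?_⟩
  have hr0 : 0 ≤ r := (norm_nonneg R).trans hK
  refine tsum_of_norm_bounded (hasSum_geometric_of_lt_one hr0 hr) fun n => ?_
  -- The zeroth power is separate, as `‖id‖` may be 0 when `X` is trivial.
  rcases n with _ | n
  · rw [pow_zero, pow_zero]
    exact ContinuousLinearMap.norm_id_le
  · exact (norm_pow_le' R n.succ_pos).trans (pow_le_pow_left₀ (norm_nonneg _) hK _)

end StoppingTime

end

/-! ### Factorization of the identity through `T` -/

theorem theorem5 {E : Type*} [NormedAddCommGroup E] [NormedSpace ℝ E] [CompleteSpace E]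
    (b : SchauderBasis ℝ E) (hsub : StoppingTime.IsSubsymmetric b)
    (hE : StoppingTime.IncomparablyNonC0 b)
    (T : StoppingTime.DSpace b →L[ℝ] StoppingTime.DSpace b) (δ : ℝ)
    (hδ : δ = ⨅ s : StoppingTime.Node, |T (StoppingTime.f b s) (StoppingTime.e b s)|)
    (hpos : 0 < δ) (η : ℝ) (hη : 0 < η) :
    ∃ A B : StoppingTime.DSpace b →L[ℝ] StoppingTime.DSpace b,
      A ∘L T ∘L B = ContinuousLinearMap.id ℝ (StoppingTime.DSpace b) ∧
        ‖A‖ * ‖B‖ ≤ (1 + η) / δ := by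
  open StoppingTime in
  have hc : 0 < ‖vec b []‖ := norm_pos_iff.2 (vec_ne_zero b [])
  have hdiag : ∀ t, δ ≤ |T (f b t) (e b t)| := fun t => by
    rw [hδ]
    exact ciInf_le ⟨0, by rintro _ ⟨t, rfl⟩; exact abs_nonneg _⟩ t
  -- Chosen so that `(1 - r)⁻¹ = 1 + η`.
  set r : ℝ := η / (1 + η) with hr
  have hr0 : 0 < r := by positivity
  have hr1 : r < 1 := by rw [hr, div_lt_one (by positivity)]; linarith
  obtain ⟨s, hlen, hl, hrt, hsmall⟩ := exists_subtree hsub hE T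
    -- The factor `δ` absorbs the inverse diagonal; the rest is the decay required by
    -- `norm_le_of_coeff_le`.
    (ε := fun n => δ * (r * ‖vec b []‖ * (1 / 2) ^ (n + 1))) (fun n => by positivity)
  let σ : Node → Node := fun t => s t.number
  have hσ : IsTreeEmbedding σ := isTreeEmbedding_of_seq hlen hl hrt
  let d : Node → ℝ := fun t => T (f b (σ t)) (e b (σ t))
  have hd : ∀ t, |(d t)⁻¹| ≤ δ⁻¹ := fun t => by
    rw [abs_inv]
    exact inv_anti₀ hpos (hdiag _)
  have hd0 : ∀ t, d t ≠ 0 := fun t h => by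
    have := hdiag (σ t)
    change δ ≤ |d t| at this
    rw [h, abs_zero] at this
    linarith
  -- `B` sends `f b t` to `f b (σ t)`; `A₀` reads the coordinates at the nodes `σ t` and divides by
  -- the diagonal.
  let B : DSpace b →L[ℝ] DSpace b := pullback (pull b hσ.injective)
  let A₀ : DSpace b →L[ℝ] DSpace b := pullback (mult b fun t => (d t)⁻¹) ∘L pullback (push b σ)
  have hB : ‖B‖ ≤ 1 := norm_pullback_le zero_le_one (norm_pull_le hsub.2 hσ)
  have hA₀ : ‖A₀‖ ≤ δ⁻¹ := by
    refine (ContinuousLinearMap.opNorm_comp_le _ _).trans ?_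
    have h1 := norm_pullback_le (inv_nonneg.2 hpos.le)
      (norm_mult_le hsub.1 (inv_nonneg.2 hpos.le) hd)
    have h2 := norm_pullback_le zero_le_one (norm_push_le hsub.2 hσ)
    simpa using mul_le_mul h1 h2 (ContinuousLinearMap.opNorm_nonneg _) (inv_nonneg.2 hpos.le)
  have hcoeff : ∀ (g : DSpace b) (t : Node),
      (A₀ ∘L T ∘L B) g (e b t) = (d t)⁻¹ * T (B g) (e b (σ t)) := by
    intro g t
    simp only [A₀, ContinuousLinearMap.comp_apply]
    rw [pullback_mult_e hsub.1 (inv_nonneg.2 hpos.le) hd, pullback_push_e hsub.2 hσ]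
  have herr : ∀ (g : DSpace b) (t : Node), |g (e b t) - (A₀ ∘L T ∘L B) g (e b t)|
      ≤ r * ‖g‖ * ‖vec b []‖ * (1 / 2) ^ (t.number + 1) := by
    intro g t
    -- The off-diagonal part of `B g`: the error at `t` is `-(d t)⁻¹` times row `σ t` applied to
    -- `h`.
    let h : DSpace b := restrD b {σ t}ᶜ (B g)
    have hsplit : B g = g (e b t) • f b (σ t) + h := DSpace.ext_e fun u => by
      rw [add_apply, smul_apply, f_e, restrD_e hsub.1]
      by_cases hu : u = σ t
      · subst hu
        rw [pullback_pull_e hsub.2 hσ]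
        simp
      · simp [hu, Ne.symm hu]
    have hsupp : SupportedOn h {v | ∃ m, m ≠ t.number ∧ s m = v} := by
      intro v hv
      rw [restrD_e hsub.1]
      split_ifs with hvt
      · refine supportedOn_pullback_pull hsub.2 hσ g v ?_
        rintro ⟨u, rfl⟩
        refine hv ⟨u.number, fun hu => hvt ?_, rfl⟩
        change σ u = σ t
        rw [Node.number_bijective.1 hu]
      · rfl
    have hh : ‖h‖ ≤ ‖g‖ :=
      (norm_restrD_apply_le hsub.1 _ _).trans (by simpa using B.le_of_opNorm_le hB g)
    have hT : |T h (e b (σ t))| ≤ δ * (r * ‖vec b []‖ * (1 / 2) ^ (t.number + 1)) * ‖g‖ :=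
      (hsmall t.number h hsupp).trans (mul_le_mul_of_nonneg_left hh (by positivity))
    have hEq : g (e b t) - (A₀ ∘L T ∘L B) g (e b t) = -((d t)⁻¹ * T h (e b (σ t))) := by
      have h1 : T (B g) (e b (σ t)) = g (e b t) * d t + T h (e b (σ t)) := by
        rw [hsplit, map_add, map_smul]; rfl
      rw [hcoeff, h1]
      have := hd0 t
      field_simp
      ring
    rw [hEq, abs_neg, abs_mul]
    refine (mul_le_mul (hd t) hT (abs_nonneg _) (inv_nonneg.2 hpos.le)).trans_eq ?_
    field_simp
  obtain ⟨L, hL, hLn⟩ := exists_leftInverse_of_norm_sub_le (A₀ ∘L T ∘L B) hr1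
    (ContinuousLinearMap.opNorm_le_bound _ hr0.le fun g =>
      norm_le_of_coeff_le hsub.2 (by positivity) (herr g))
  refine ⟨L ∘L A₀, B, hL, ?_⟩
  have hr2 : (1 - r)⁻¹ = 1 + η := by
    rw [hr]; field_simp; ring
  calc ‖L ∘L A₀‖ * ‖B‖ ≤ ((1 + η) * δ⁻¹) * 1 := by
        refine mul_le_mul ?_ hB B.opNorm_nonneg (by positivity)
        refine (ContinuousLinearMap.opNorm_comp_le _ _).trans ?_
        exact mul_le_mul (hLn.trans_eq hr2) hA₀ A₀.opNorm_nonneg (by positivity)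
    _ = (1 + η) / δ := by rw [mul_one, div_eq_mul_inv]
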